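/- Let $G$ be a finite group, $N$ a normal subgroup of $G$, and $C$ a cyclic group of order $|G|$. For a subgroup $H\leqslant G$ let $C_H$ denote the unique subgroup of $C$ of order $|H|$. For a finite group $A$ let $B(A)$ be its Burnside ring, i.e. the Grothendieck ring of finite $A$-sets under disjoint union and cartesian product, and for $U\leqslant A$ let $x\mapsto |x^U|$ be the ring homomorphism $B(A)\to\mathbb Z$ extending $X\mapsto |X^U|$, the number of $U$-fixed points. For a cyclic group $D$ with $|D|=|A|$, the Frobenius--Wielandt (FW) morphism $\alpha^A:B(D)\to B(A)$ is the unique ring homomorphism such that $|\alpha^A(x)^U|=|x^{V}|$ for all $x\in B(D)$ and all $U\leqslant A$, where $V$ is the subgroup of $D$ of order $|U|$. For a normal subgroup $M$ of $A$, the deflation $\mathrm{Def}^A_{A/M}:B(A)\to B(A/M)$ is the additive map sending the class of a finite $A$-set $X$ to the class of the $A/M$-set $M\backslash X$ of $M$-orbits. For a normal subgroup $K$ of a finite group $L$ put $$m_{L,K}=\frac1{|L|}\sum_{X\leqslant L,\ XK=L}|X|\,\mu(X,L),$$ where $\mu$ is the Möbius function of the poset of subgroups of $L$. Suppose that for $G$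 and $N$ the FW morphism commutes with deflation, that is, $$\mathrm{Def}^G_{G/N}\circ\alpha^G=\alpha^{G/N}\circ\mathrm{Def}^C_{C/C_N}$$ as maps $B(C)\to B(G/N)$, where $\alpha^{G/N}:B(C/C_N)\to B(G/N)$ is the FW morphism for the cyclic group $C/C_N$ of order $|G/N|$. Then for every subgroup $T$ of $G$ containing $N$, $$m_{T,N}=m_{C_T,C_N}.$$ -/

import Mathlib

open scoped Pointwise

universe u v

namespace Burnside

/-! ### Finite `G`-sets and the Burnside ring -/

/-- A finite (left) `G`-set. -/
structure FinGSet (G : Type u) [Group G] : Type (u + 1) where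
  carrier : Type u
  [action : MulAction G carrier]
  [finite : Finite carrier]

attribute [instance] FinGSet.action FinGSet.finite

/-- Isomorphism of finite `G`-sets: a `G`-equivariant bijection. -/
instance FinGSet.setoid (G : Type u) [Group G] : Setoid (FinGSet G) where
  r X Y := ∃ e : X.carrier ≃ Y.carrier, ∀ (g : G) (x : X.carrier), e (g • x) = g • e x
  iseqv :=
    { refl := fun X => ⟨Equiv.refl _, fun _ _ => rfl⟩
      symm := fun {X Y} ⟨e, he⟩ => ⟨e.symm, fun g y => by
        rw [Equiv.symm_apply_eq, he, Equiv.apply_symm_apply]⟩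
      trans := fun {X Y Z} ⟨e, he⟩ ⟨f, hf⟩ => ⟨e.trans f, fun g x => by simp [he, hf]⟩ }

/-- The type of isomorphism classes of finite `G`-sets. -/
def IsoClass (G : Type u) [Group G] : Type (u + 1) := Quotient (FinGSet.setoid G)

/-- The isomorphism class of a finite `G`-set. -/
def isoClass (G : Type u) [Group G] (X : Type u) [MulAction G X] [Finite X] : IsoClass G :=
  Quotient.mk _ ⟨X⟩

section IsoClass

variable {G : Type u} [Group G]

/-- The empty `G`-set. -/
instance : MulAction G PEmpty.{u + 1} where
  smul _ x := x
  one_smul _ := rfl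
  mul_smul _ _ _ := rfl

theorem isoClass_surjective (m : IsoClass G) : ∃ X : FinGSet G, m = isoClass G X.carrier :=
  Quotient.inductionOn m fun X => ⟨X, rfl⟩

theorem isoClass_congr {X Y : Type u} [MulAction G X] [Finite X] [MulAction G Y] [Finite Y]
    (e : X ≃ Y) (he : ∀ (g : G) (x : X), e (g • x) = g • e x) :
    isoClass G X = isoClass G Y :=
  Quotient.sound ⟨e, he⟩

/-- Isomorphism classes of finite `G`-sets form a commutative monoid under the cartesian product
(with the diagonal action), the unit being the one-point set. -/
instance : CommMonoid (IsoClass G) where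
  mul := Quotient.map₂ (fun X Y => ⟨X.carrier × Y.carrier⟩) (by
    rintro X X' ⟨e, he⟩ Y Y' ⟨f, hf⟩
    exact ⟨e.prodCongr f, fun g x => Prod.ext (he g x.1) (hf g x.2)⟩)
  one := isoClass G PUnit
  mul_assoc := by
    rintro ⟨X⟩ ⟨Y⟩ ⟨Z⟩
    exact Quotient.sound ⟨Equiv.prodAssoc _ _ _, fun g x => rfl⟩
  one_mul := by
    rintro ⟨X⟩
    exact Quotient.sound ⟨Equiv.punitProd _, fun g x => rfl⟩
  mul_one := by
    rintro ⟨X⟩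
    exact Quotient.sound ⟨Equiv.prodPUnit _, fun g x => rfl⟩
  mul_comm := by
    rintro ⟨X⟩ ⟨Y⟩
    exact Quotient.sound ⟨Equiv.prodComm _ _, fun g x => rfl⟩

theorem isoClass_prod (X Y : Type u) [MulAction G X] [Finite X] [MulAction G Y] [Finite Y] :
    isoClass G (X × Y) = isoClass G X * isoClass G Y := rfl

end IsoClass

/-- The relations `[X ⊔ Y] - [X] - [Y]`. -/
def relations (G : Type u) [Group G] : Set (MonoidAlgebra ℤ (IsoClass G)) :=
  Set.range fun p : FinGSet G × FinGSet G =>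
    MonoidAlgebra.of ℤ (IsoClass G) (isoClass G (p.1.carrier ⊕ p.2.carrier))
      - MonoidAlgebra.of ℤ (IsoClass G) (isoClass G p.1.carrier)
      - MonoidAlgebra.of ℤ (IsoClass G) (isoClass G p.2.carrier)

/-- The Burnside ring `B(G)`: the free abelian group on the isomorphism classes of finite `G`-sets,
with multiplication induced by the cartesian product, modulo the relations
`[X ⊔ Y] = [X] + [Y]`. -/
def BurnsideRing (G : Type u) [Group G] : Type (u + 1) :=
  MonoidAlgebra ℤ (IsoClass G) ⧸ Ideal.span (relations G)

noncomputable instance (G : Type u) [Group G] : CommRing (BurnsideRing G) :=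
  inferInstanceAs (CommRing (MonoidAlgebra ℤ (IsoClass G) ⧸ Ideal.span (relations G)))

/-- The class `[X]` of a finite `G`-set in the Burnside ring `B(G)`. -/
noncomputable def cls (G : Type u) [Group G] (X : Type u) [MulAction G X] [Finite X] :
    BurnsideRing G :=
  Ideal.Quotient.mk (Ideal.span (relations G)) (MonoidAlgebra.of ℤ (IsoClass G) (isoClass G X))

section Basic

variable {G : Type u} [Group G]

theorem cls_congr {X Y : Type u} [MulAction G X] [Finite X] [MulAction G Y] [Finite Y]
    (e : X ≃ Y) (he : ∀ (g : G) (x : X), e (g • x) = g • e x) : cls G X = cls G Y := by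
  unfold cls
  rw [isoClass_congr e he]

theorem cls_sum (X Y : Type u) [MulAction G X] [Finite X] [MulAction G Y] [Finite Y] :
    cls G (X ⊕ Y) = cls G X + cls G Y := by
  rw [← sub_eq_zero, ← sub_sub]
  have h : MonoidAlgebra.of ℤ (IsoClass G) (isoClass G (X ⊕ Y))
      - MonoidAlgebra.of ℤ (IsoClass G) (isoClass G X)
      - MonoidAlgebra.of ℤ (IsoClass G) (isoClass G Y) ∈ Ideal.span (relations G) :=
    Ideal.subset_span ⟨(⟨X⟩, ⟨Y⟩), rfl⟩
  exact Ideal.Quotient.eq_zero_iff_mem.mpr h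

theorem cls_prod (X Y : Type u) [MulAction G X] [Finite X] [MulAction G Y] [Finite Y] :
    cls G (X × Y) = cls G X * cls G Y := by
  unfold cls
  rw [isoClass_prod, map_mul]
  exact map_mul (Ideal.Quotient.mk (Ideal.span (relations G))) _ _

theorem cls_punit : cls G PUnit = 1 :=
  (congrArg (Ideal.Quotient.mk (Ideal.span (relations G)))
    (map_one (MonoidAlgebra.of ℤ (IsoClass G)))).trans
      (map_one (Ideal.Quotient.mk (Ideal.span (relations G))))

theorem cls_of_isEmpty (X : Type u) [MulAction G X] [Finite X] [IsEmpty X] : cls G X = 0 := by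
  have h : cls G (X ⊕ X) = cls G X :=
    cls_congr (Equiv.sumEmpty X X) (fun g x => by
      rcases x with x | x <;> exact isEmptyElim x)
  rw [cls_sum] at h
  simpa using h

/-- The Burnside ring is generated as an additive group by the classes of finite `G`-sets. -/
theorem BurnsideRing.induction {p : BurnsideRing G → Prop}
    (hcls : ∀ (X : Type u) [MulAction G X] [Finite X], p (cls G X))
    (hadd : ∀ a b, p a → p b → p (a + b)) (hneg : ∀ a, p a → p (-a)) (a : BurnsideRing G) :
    p a := by
  have h0 : p 0 := by
    have := hadd _ _ (hcls PEmpty.{u+1}) (hneg _ (hcls PEmpty.{u+1}))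
    rwa [add_neg_cancel] at this
  obtain ⟨a, rfl⟩ := Ideal.Quotient.mk_surjective a
  induction a using MonoidAlgebra.induction_linear with
  | zero => rw [map_zero]; exact h0
  | add f g hf hg => rw [map_add]; exact hadd _ _ hf hg
  | single m r =>
    obtain ⟨X, rfl⟩ := isoClass_surjective m
    have e : (MonoidAlgebra.single (isoClass G X.carrier) r : MonoidAlgebra ℤ (IsoClass G))
        = r • MonoidAlgebra.of ℤ (IsoClass G) (isoClass G X.carrier) := by
      rw [MonoidAlgebra.of_apply, MonoidAlgebra.smul_single, smul_eq_mul, mul_one]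
    rw [e, map_zsmul]
    have hn : ∀ n : ℕ, p (n • cls G X.carrier) := by
      intro n
      induction n with
      | zero => rw [zero_smul]; exact h0
      | succ n ih => rw [succ_nsmul]; exact hadd _ _ ih (hcls _)
    change p (r • cls G X.carrier)
    obtain ⟨n, rfl | rfl⟩ := r.eq_nat_or_neg
    · rw [natCast_zsmul]; exact hn n
    · rw [neg_smul, natCast_zsmul]; exact hneg _ (hn n)

theorem BurnsideRing.exists_sub (a : BurnsideRing G) :
    ∃ X Y : FinGSet G, a = cls G X.carrier - cls G Y.carrier := by
  induction a using BurnsideRing.induction with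
  | hcls X => exact ⟨⟨X⟩, ⟨PEmpty⟩, by rw [cls_of_isEmpty PEmpty, sub_zero]⟩
  | hadd a b ha hb =>
    obtain ⟨X, Y, rfl⟩ := ha
    obtain ⟨Z, W, rfl⟩ := hb
    refine ⟨⟨X.carrier ⊕ Z.carrier⟩, ⟨Y.carrier ⊕ W.carrier⟩, ?_⟩
    simp only [cls_sum]
    abel
  | hneg a ha =>
    obtain ⟨X, Y, rfl⟩ := ha
    exact ⟨Y, X, by abel⟩

/-- The universal property of `B(G)` as an abelian group: an isomorphism invariant of finite
`G`-sets which is additive on disjoint unions extends uniquely to `B(G)`. -/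
noncomputable def addLift {A : Type*} [AddCommGroup A] (f : IsoClass G → A)
    (hf : ∀ X Y : FinGSet G, f (isoClass G (X.carrier ⊕ Y.carrier))
      = f (isoClass G X.carrier) + f (isoClass G Y.carrier)) :
    BurnsideRing G →+ A :=
  let φ : MonoidAlgebra ℤ (IsoClass G) →+ A :=
    (Finsupp.liftAddHom fun m => zmultiplesHom A (f m)).comp
      { toFun := MonoidAlgebra.coeff, map_zero' := rfl, map_add' := fun _ _ => rfl }
  have hφ : ∀ (m : IsoClass G) (r : ℤ), φ (MonoidAlgebra.single m r) = r • f m := by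
    intro m r
    change (Finsupp.liftAddHom fun m => zmultiplesHom A (f m)) (Finsupp.single m r) = _
    simp
  QuotientAddGroup.lift (Submodule.toAddSubgroup (Ideal.span (relations G))) φ (by
    intro x hx
    have key : ∀ a : MonoidAlgebra ℤ (IsoClass G), φ (a * x) = 0 := by
      refine Submodule.span_induction
        (p := fun x _ => ∀ a : MonoidAlgebra ℤ (IsoClass G), φ (a * x) = 0) ?_ ?_ ?_ ?_ hx
      · rintro _ ⟨⟨X, Y⟩, rfl⟩ a
        induction a using MonoidAlgebra.induction_linear with
        | zero => simp
        | add a b ha hb => rw [add_mul, map_add, ha, hb, add_zero]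
        | single m r =>
          obtain ⟨Z, rfl⟩ := isoClass_surjective m
          have hd : isoClass G Z.carrier * isoClass G (X.carrier ⊕ Y.carrier)
              = isoClass G ((Z.carrier × X.carrier) ⊕ (Z.carrier × Y.carrier)) :=
            isoClass_congr (G := G) (X := Z.carrier × (X.carrier ⊕ Y.carrier))
              (Equiv.prodSumDistrib _ _ _) (by rintro g ⟨z, x | y⟩ <;> rfl)
          simp only [MonoidAlgebra.of_apply, mul_sub, MonoidAlgebra.single_mul_single, mul_one,
            map_sub, hφ]
          rw [hd, hf ⟨Z.carrier × X.carrier⟩ ⟨Z.carrier × Y.carrier⟩, smul_add]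
          change r • f (isoClass G (Z.carrier × X.carrier))
            + r • f (isoClass G (Z.carrier × Y.carrier))
            - r • f (isoClass G (Z.carrier × X.carrier))
            - r • f (isoClass G (Z.carrier × Y.carrier)) = 0
          abel
      · simp
      · intro x y _ _ hx hy a
        rw [mul_add, map_add, hx, hy, add_zero]
      · intro b x _ hx a
        rw [smul_eq_mul, ← mul_assoc, hx]
    simpa using key 1)

theorem addLift_cls {A : Type*} [AddCommGroup A] (f : IsoClass G → A)
    (hf : ∀ X Y : FinGSet G, f (isoClass G (X.carrier ⊕ Y.carrier))
      = f (isoClass G X.carrier) + f (isoClass G Y.carrier))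
    (X : Type u) [MulAction G X] [Finite X] :
    addLift f hf (cls G X) = f (isoClass G X) := by
  change (Finsupp.liftAddHom fun m => zmultiplesHom A (f m))
    (Finsupp.single (isoClass G X) (1 : ℤ)) = _
  simp

end Basic

/-! ### Fixed points -/

section Mark

variable {G : Type u} [Group G]

/-- The number of `U`-fixed points, on isomorphism classes of finite `G`-sets. -/
noncomputable def markClass (U : Subgroup G) : IsoClass G →* ℤ where
  toFun := Quotient.lift (fun X => (Nat.card (MulAction.fixedPoints U X.carrier) : ℤ)) (by
    rintro X Y ⟨e, he⟩
    simp only [Nat.cast_inj]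
    refine Nat.card_congr (e.subtypeEquiv fun x => ?_)
    refine forall_congr' fun g => ?_
    exact ⟨fun h => (he g x).symm.trans (congrArg e h), fun h => e.injective ((he g x).trans h)⟩)
  map_one' := by
    change ((Nat.card (MulAction.fixedPoints U PUnit) : ℕ) : ℤ) = 1
    have : MulAction.fixedPoints U PUnit = Set.univ := by ext; simp [MulAction.fixedPoints]
    rw [this]; simp
  map_mul' := by
    rintro ⟨X⟩ ⟨Y⟩
    change ((Nat.card (MulAction.fixedPoints U (X.carrier × Y.carrier)) : ℕ) : ℤ)
      = (Nat.card (MulAction.fixedPoints U X.carrier) : ℕ)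
        * (Nat.card (MulAction.fixedPoints U Y.carrier) : ℕ)
    rw [← Nat.cast_mul, ← Nat.card_prod, Nat.cast_inj]
    refine Nat.card_congr
      ((Equiv.subtypeEquivRight fun x => ?_).trans (Equiv.subtypeProdEquivProd ..))
    simp only [MulAction.mem_fixedPoints, Prod.ext_iff]
    exact ⟨fun h => ⟨fun g => (h g).1, fun g => (h g).2⟩, fun h g => ⟨h.1 g, h.2 g⟩⟩

/-- The ring homomorphism `B(G) → ℤ`, `x ↦ |x ^ U|`, extending `[X] ↦ |X ^ U|`, the number of
fixed points of a subgroup `U` of `G`. -/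
noncomputable def mark (U : Subgroup G) : BurnsideRing G →+* ℤ :=
  Ideal.Quotient.lift (Ideal.span (relations G))
    (MonoidAlgebra.lift ℤ ℤ (IsoClass G) (markClass U)).toRingHom (by
      have hle : Ideal.span (relations G)
          ≤ RingHom.ker (MonoidAlgebra.lift ℤ ℤ (IsoClass G) (markClass U)).toRingHom := by
        refine Ideal.span_le.mpr ?_
        rintro _ ⟨⟨X, Y⟩, rfl⟩
        have h : Nat.card (MulAction.fixedPoints U (X.carrier ⊕ Y.carrier))
            = Nat.card (MulAction.fixedPoints U X.carrier)
              + Nat.card (MulAction.fixedPoints U Y.carrier) := by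
          rw [← Nat.card_sum]
          refine Nat.card_congr ((Equiv.subtypeSum ..).trans (Equiv.sumCongr
            (Equiv.subtypeEquivRight fun x => ?_) (Equiv.subtypeEquivRight fun x => ?_)))
          · exact forall_congr' fun g => Sum.inl_injective.eq_iff
          · exact forall_congr' fun g => Sum.inr_injective.eq_iff
        have h' : markClass U (isoClass G (X.carrier ⊕ Y.carrier))
            = markClass U (isoClass G X.carrier) + markClass U (isoClass G Y.carrier) := by
          change ((Nat.card (MulAction.fixedPoints U (X.carrier ⊕ Y.carrier)) : ℕ) : ℤ)
            = (Nat.card (MulAction.fixedPoints U X.carrier) : ℕ)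
              + (Nat.card (MulAction.fixedPoints U Y.carrier) : ℕ)
          rw [h, Nat.cast_add]
        simp [h']
      exact fun a ha => hle ha)

theorem mark_cls (U : Subgroup G) (X : Type u) [MulAction G X] [Finite X] :
    mark U (cls G X) = Nat.card (MulAction.fixedPoints U X) := by
  change MonoidAlgebra.lift ℤ ℤ (IsoClass G) (markClass U)
    (MonoidAlgebra.of ℤ (IsoClass G) (isoClass G X)) = _
  rw [MonoidAlgebra.lift_of]
  rfl

end Mark

/-! ### An element of the Burnside ring is determined by its numbers of fixed points -/

section Decomposition

variable {G : Type u} [Group G]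

/-- The orbit of a point, as a sub-`G`-set. -/
def orbitSub {X : Type u} [MulAction G X] (x : X) : SubMulAction G X where
  carrier := MulAction.orbit G x
  smul_mem' g _ hy := MulAction.mem_orbit_of_mem_orbit g hy

/-- The complement of a sub-`G`-set, as a sub-`G`-set. -/
def complSub {X : Type u} [MulAction G X] (S : SubMulAction G X) : SubMulAction G X where
  carrier := (S : Set X)ᶜ
  smul_mem' g x hy h := hy (by
    have h' := S.smul_mem g⁻¹ h
    rwa [inv_smul_smul] at h')

theorem cls_eq_add_compl {X : Type u} [MulAction G X] [Finite X] (S : SubMulAction G X) :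
    cls G X = cls G S + cls G (complSub S) := by
  classical
  rw [← cls_sum]
  refine (cls_congr (G := G) (X := S ⊕ complSub S) (Equiv.Set.sumCompl (S : Set X)) ?_).symm
  rintro g (x | x) <;> rfl

theorem cls_orbitSub [Finite G] {X : Type u} [MulAction G X] [Finite X] (x : X) :
    cls G (orbitSub (G := G) x) = cls G (G ⧸ MulAction.stabilizer G x) := by
  refine (cls_congr (MulAction.orbitEquivQuotientStabilizer G x).symm ?_).symm
  intro g y
  induction y using QuotientGroup.induction_on with
  | H h =>
    refine Subtype.ext ?_
    change (((MulAction.orbitEquivQuotientStabilizer G x).symm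
      ((g * h : G) : G ⧸ MulAction.stabilizer G x) : X))
      = g • (((MulAction.orbitEquivQuotientStabilizer G x).symm
      (h : G ⧸ MulAction.stabilizer G x) : X))
    rw [MulAction.orbitEquivQuotientStabilizer_symm_apply,
      MulAction.orbitEquivQuotientStabilizer_symm_apply, mul_smul]

theorem card_complSub_lt {X : Type u} [MulAction G X] [Finite X] (x : X) :
    Nat.card (complSub (orbitSub (G := G) x)) < Nat.card X := by
  have h : Nat.card X = Nat.card (orbitSub (G := G) x)
      + Nat.card (complSub (orbitSub (G := G) x)) := by
    classical
    rw [← Nat.card_sum]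
    exact Nat.card_congr (Equiv.Set.sumCompl (orbitSub (G := G) x : Set X)).symm
  have : Nonempty (orbitSub (G := G) x) := ⟨⟨x, MulAction.mem_orbit_self x⟩⟩
  have := Nat.card_pos (α := orbitSub (G := G) x)
  omega

theorem mark_bot_cls (X : Type u) [MulAction G X] [Finite X] :
    mark (⊥ : Subgroup G) (cls G X) = Nat.card X := by
  rw [mark_cls]
  have : MulAction.fixedPoints (⊥ : Subgroup G) X = Set.univ := by
    ext x
    simp only [MulAction.mem_fixedPoints, Set.mem_univ, iff_true]
    rintro ⟨g, hg⟩
    rw [Subgroup.mem_bot] at hg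
    subst hg
    exact one_smul G x
  rw [this, Nat.card_univ]

theorem exists_le_stabilizer {X : Type u} [MulAction G X] [Finite X] (U : Subgroup G)
    (h : mark U (cls G X) ≠ 0) : ∃ x : X, U ≤ MulAction.stabilizer G x := by
  rw [mark_cls, Nat.cast_ne_zero] at h
  obtain ⟨⟨⟨x, hx⟩⟩, _⟩ := Nat.card_ne_zero.mp h
  exact ⟨x, fun g hg => hx ⟨g, hg⟩⟩

theorem mark_ne_zero_of_le {X : Type u} [MulAction G X] [Finite X] {U : Subgroup G} {x : X}
    (h : U ≤ MulAction.stabilizer G x) : mark U (cls G X) ≠ 0 := by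
  rw [mark_cls, Nat.cast_ne_zero, Nat.card_ne_zero]
  exact ⟨⟨⟨x, fun g => h g.2⟩⟩, inferInstance⟩

theorem cls_eq_of_mark [Finite G] (n : ℕ) :
    ∀ (X Y : Type u) [MulAction G X] [Finite X] [MulAction G Y] [Finite Y], Nat.card X = n →
      (∀ U : Subgroup G, mark U (cls G X) = mark U (cls G Y)) → cls G X = cls G Y := by
  induction n using Nat.strong_induction_on with
  | _ n ih =>
    intro X Y _ _ _ _ hn h
    rcases isEmpty_or_nonempty X with hX | hX
    · have h0 := h ⊥
      rw [mark_bot_cls, mark_bot_cls, Nat.card_of_isEmpty, Nat.cast_inj] at h0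
      have hY : IsEmpty Y := (Nat.card_eq_zero.mp h0.symm).resolve_right (not_infinite_iff_finite.mpr inferInstance)
      rw [cls_of_isEmpty, cls_of_isEmpty]
    · obtain ⟨x, hx⟩ := Finite.exists_max fun x : X => Nat.card (MulAction.stabilizer G x)
      obtain ⟨y, hy⟩ := exists_le_stabilizer (X := Y) (MulAction.stabilizer G x)
        (h _ ▸ mark_ne_zero_of_le le_rfl)
      obtain ⟨x', hx'⟩ := exists_le_stabilizer (X := X) (MulAction.stabilizer G y)
        ((h _).symm ▸ mark_ne_zero_of_le le_rfl)
      have hxy : MulAction.stabilizer G x = MulAction.stabilizer G y :=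
        Subgroup.eq_of_le_of_card_ge hy ((Subgroup.card_le_of_le hx').trans (hx x'))
      have ho : cls G (orbitSub (G := G) x) = cls G (orbitSub (G := G) y) := by
        rw [cls_orbitSub, cls_orbitSub, hxy]
      have hX' := cls_eq_add_compl (orbitSub (G := G) x)
      have hY' := cls_eq_add_compl (orbitSub (G := G) y)
      rw [hX', hY', ho]
      congr 1
      refine ih _ (hn ▸ card_complSub_lt (G := G) x) _ _ rfl fun U => ?_
      have hU := h U
      rw [hX', hY', ho, map_add, map_add] at hU
      exact add_left_cancel hU

/-- An element of `B(G)` is determined by its numbers of fixed points. -/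
theorem mark_ext [Finite G] {a b : BurnsideRing G} (h : ∀ U : Subgroup G, mark U a = mark U b) :
    a = b := by
  obtain ⟨X, Y, hXY⟩ := BurnsideRing.exists_sub (a - b)
  have : cls G X.carrier = cls G Y.carrier := by
    refine cls_eq_of_mark _ _ _ rfl fun U => ?_
    rw [← sub_eq_zero, ← map_sub, ← hXY, map_sub, h, sub_self]
  rw [this, sub_self] at hXY
  exact sub_eq_zero.mp hXY

end Decomposition

/-! ### The Frobenius-Wielandt morphism -/

section FrobeniusWielandt

/-- The `G`-set of all subsets of `G` with `d` elements, `G` acting by left translation. -/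
def SubsetsOfCard (G : Type u) [Group G] (d : ℕ) : Type u := {A : Set G // A.ncard = d}

instance (G : Type u) [Group G] (d : ℕ) : MulAction G (SubsetsOfCard G d) where
  smul g A := ⟨g • A.1, (Set.ncard_smul_set g A.1).trans A.2⟩
  one_smul A := Subtype.ext (one_smul G A.1)
  mul_smul g h A := Subtype.ext (mul_smul g h A.1)

instance (G : Type u) [Group G] [Finite G] (d : ℕ) : Finite (SubsetsOfCard G d) :=
  inferInstanceAs (Finite {A : Set G // A.ncard = d})

theorem ncard_preimage_mk {G : Type u} [Group G] [Finite G] (U : Subgroup G) (T : Set (G ⧸ U)) :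
    ((fun a : G => ((a⁻¹ : G) : G ⧸ U)) ⁻¹' T).ncard = T.ncard * Nat.card U := by
  rw [← Nat.card_coe_set_eq, ← Nat.card_coe_set_eq, ← Nat.card_prod]
  refine Nat.card_congr ?_
  refine ((Equiv.inv G).subtypeEquiv (q := fun a : G => (a : G ⧸ U) ∈ T) fun a => Iff.rfl).trans ?_
  exact (QuotientGroup.preimageMkEquivSubgroupProdSet U T).trans (Equiv.prodComm _ _)

theorem card_fixedPoints_subsetsOfCard {G : Type u} [Group G] [Finite G] (U : Subgroup G)
    (d : ℕ) : Nat.card (MulAction.fixedPoints U (SubsetsOfCard G d))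
      = Nat.card {T : Set (G ⧸ U) // T.ncard * Nat.card U = d} := by
  have hfix : ∀ (T : {T : Set (G ⧸ U) // T.ncard * Nat.card U = d}) (g : U),
      (g : G) • (fun a : G => ((a⁻¹ : G) : G ⧸ U)) ⁻¹' T.1
        = (fun a : G => ((a⁻¹ : G) : G ⧸ U)) ⁻¹' T.1 := by
    intro T g
    ext a
    rw [Set.mem_smul_set_iff_inv_smul_mem]
    simp only [Set.mem_preimage, smul_eq_mul, mul_inv_rev, inv_inv]
    rw [QuotientGroup.mk_mul_of_mem _ g.2]
  let F : {T : Set (G ⧸ U) // T.ncard * Nat.card U = d}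
      → MulAction.fixedPoints U (SubsetsOfCard G d) := fun T =>
    ⟨⟨(fun a : G => ((a⁻¹ : G) : G ⧸ U)) ⁻¹' T.1, (ncard_preimage_mk U T.1).trans T.2⟩,
      fun g => Subtype.ext (hfix T g)⟩
  refine (Nat.card_congr (Equiv.ofBijective F ⟨?_, ?_⟩)).symm
  · intro T T' h
    have h' := congrArg (fun A => A.1.1) h
    refine Subtype.ext (Set.preimage_injective.mpr ?_ h')
    intro q
    induction q using QuotientGroup.induction_on with
    | H a => exact ⟨a⁻¹, by simp⟩
  · rintro ⟨⟨A, hA⟩, hfix⟩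
    have hmem : ∀ u ∈ U, ∀ a, a ∈ A → u * a ∈ A := by
      intro u hu a ha
      have h : u • A = A := congrArg Subtype.val (hfix ⟨u, hu⟩)
      rw [← h]
      exact Set.smul_mem_smul_set ha
    have hpre : (fun a : G => ((a⁻¹ : G) : G ⧸ U)) ⁻¹' ((fun a : G => ((a⁻¹ : G) : G ⧸ U)) '' A)
        = A := by
      refine Set.Subset.antisymm ?_ (Set.subset_preimage_image _ _)
      rintro b ⟨a, ha, hab⟩
      have hab' := QuotientGroup.eq.mp hab
      have := hmem _ (U.inv_mem hab') a ha
      simpa using this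
    refine ⟨⟨(fun a : G => ((a⁻¹ : G) : G ⧸ U)) '' A, ?_⟩, Subtype.ext (Subtype.ext hpre)⟩
    rw [← ncard_preimage_mk, hpre, hA]

theorem card_quotient_eq {G : Type u} {C : Type v} [Group G] [Group C] [Finite G]
    (h : Nat.card C = Nat.card G) {U : Subgroup G} {V : Subgroup C}
    (hUV : Nat.card V = Nat.card U) : Nat.card (C ⧸ V) = Nat.card (G ⧸ U) := by
  have h1 := Subgroup.card_eq_card_quotient_mul_card_subgroup U
  have h2 := Subgroup.card_eq_card_quotient_mul_card_subgroup V
  rw [h, h1, hUV] at h2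
  exact (Nat.eq_of_mul_eq_mul_right Nat.card_pos h2).symm

theorem card_fixedPoints_subsetsOfCard_eq {G : Type u} {C : Type v} [Group G] [Group C]
    [Finite G] [Finite C] (h : Nat.card C = Nat.card G) {U : Subgroup G} {V : Subgroup C}
    (hUV : Nat.card V = Nat.card U) (d : ℕ) :
    Nat.card (MulAction.fixedPoints U (SubsetsOfCard G d))
      = Nat.card (MulAction.fixedPoints V (SubsetsOfCard C d)) := by
  rw [card_fixedPoints_subsetsOfCard, card_fixedPoints_subsetsOfCard, hUV]
  have e : C ⧸ V ≃ G ⧸ U := (Finite.card_eq.mp (card_quotient_eq h hUV)).some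
  refine (Nat.card_congr ((Equiv.Set.congr e).subtypeEquiv fun T => ?_)).symm
  change _ ↔ (e '' T).ncard * _ = _
  rw [Set.ncard_image_of_injective _ e.injective]

/-- A cyclic group has at most one subgroup of each order. -/
theorem subgroup_eq_of_card_eq {C : Type v} [CommGroup C] [IsCyclic C] [Finite C]
    {V W : Subgroup C} (h : Nat.card V = Nat.card W) : V = W := by
  have key : ∀ V : Subgroup C, V = (powMonoidHom (Nat.card V) : C →* C).ker := by
    intro V
    refine Subgroup.eq_of_le_of_card_ge (fun x hx => ?_) ?_
    · have := pow_card_eq_one' (x := (⟨x, hx⟩ : V))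
      exact congrArg Subtype.val this
    · rw [IsCyclic.card_powMonoidHom_ker]
      exact Nat.gcd_le_right _ Nat.card_pos
  rw [key V, key W, h]

/-- A finite cyclic group has a subgroup of every order dividing its own order. -/
theorem exists_subgroup_card {C : Type v} [CommGroup C] [IsCyclic C] [Finite C] {n : ℕ}
    (h : n ∣ Nat.card C) : ∃ V : Subgroup C, Nat.card V = n :=
  ⟨(powMonoidHom n : C →* C).ker, by
    rw [IsCyclic.card_powMonoidHom_ker, Nat.gcd_eq_right h]⟩

variable (G : Type u) (C : Type v) [Group G] [CommGroup C]

/-- The elements of `B(C)` having an image in `B(G)` with the prescribed fixed points. -/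
def fwDomain : AddSubgroup (BurnsideRing C) where
  carrier := {x | ∃ y : BurnsideRing G, ∀ (U : Subgroup G) (V : Subgroup C),
    Nat.card V = Nat.card U → mark U y = mark V x}
  zero_mem' := ⟨0, fun U V _ => by rw [map_zero, map_zero]⟩
  add_mem' := by
    rintro a b ⟨y, hy⟩ ⟨z, hz⟩
    exact ⟨y + z, fun U V h => by rw [map_add, map_add, hy U V h, hz U V h]⟩
  neg_mem' := by
    rintro a ⟨y, hy⟩
    exact ⟨-y, fun U V h => by rw [map_neg, map_neg, hy U V h]⟩

variable {G C}

theorem cls_mem_fwDomain_of_stabilizer [Finite C] {d : ℕ}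
    (h : ∀ D : Subgroup C, Nat.card D < d → cls C (C ⧸ D) ∈ fwDomain G C) (n : ℕ) :
    ∀ (X : Type v) [MulAction C X] [Finite X], Nat.card X = n →
      (∀ x : X, Nat.card (MulAction.stabilizer C x) < d) → cls C X ∈ fwDomain G C := by
  induction n using Nat.strong_induction_on with
  | _ n ih =>
    intro X _ _ hn hX
    rcases isEmpty_or_nonempty X with hE | ⟨⟨x⟩⟩
    · rw [cls_of_isEmpty]
      exact zero_mem _
    · rw [cls_eq_add_compl (orbitSub (G := C) x)]
      refine add_mem ?_ (ih _ (hn ▸ card_complSub_lt (G := C) x) _ rfl fun y => ?_)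
      · rw [cls_orbitSub]
        exact h _ (hX x)
      · rw [SubMulAction.stabilizer_of_subMul]
        exact hX _

variable [Finite G] [Finite C] [IsCyclic C]

theorem cls_quotient_mem_fwDomain (h : Nat.card C = Nat.card G) (d : ℕ) :
    ∀ D : Subgroup C, Nat.card D = d → cls C (C ⧸ D) ∈ fwDomain G C := by
  induction d using Nat.strong_induction_on with
  | _ d ih =>
    intro D hD
    let x : SubsetsOfCard C d := ⟨(D : Set C), hD⟩
    have hstab : MulAction.stabilizer C x = D := by
      ext g
      rw [MulAction.mem_stabilizer_iff]
      constructor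
      · intro hg
        have hg' : g • (D : Set C) = D := congrArg Subtype.val hg
        have : g • (1 : C) ∈ g • (D : Set C) := Set.smul_mem_smul_set D.one_mem
        rw [hg'] at this
        simpa using this
      · intro hg
        exact Subtype.ext (smul_coe_set hg)
    have hX : cls C (SubsetsOfCard C d) ∈ fwDomain G C :=
      ⟨cls G (SubsetsOfCard G d), fun U V hUV => by
        rw [mark_cls, mark_cls, card_fixedPoints_subsetsOfCard_eq h hUV]⟩
    have hcompl : cls C (complSub (orbitSub (G := C) x)) ∈ fwDomain G C := by
      refine cls_mem_fwDomain_of_stabilizer (d := d) (fun E hE => ih _ hE E rfl) _ _ rfl ?_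
      rintro ⟨A', hAx⟩
      rw [SubMulAction.stabilizer_of_subMul]
      set E := MulAction.stabilizer C A' with hE
      obtain ⟨A, hA, hAA⟩ : ∃ A : Set C, A.ncard = d ∧ A'.1 = A := ⟨A'.1, A'.2, rfl⟩
      have hpos : 0 < d := hD ▸ Nat.card_pos
      obtain ⟨a, ha⟩ : A.Nonempty := by
        rw [Set.nonempty_iff_ne_empty]
        rintro rfl
        rw [Set.ncard_empty] at hA
        omega
      have hsub : a • (E : Set C) ⊆ A := by
        rintro _ ⟨e, he, rfl⟩
        have he' : e • A = A := hAA ▸ congrArg (fun B : SubsetsOfCard C d => B.1) (MulAction.mem_stabilizer_iff.mp he)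
        rw [← he']
        exact ⟨a, ha, mul_comm e a⟩
      have hcard : (a • (E : Set C)).ncard = Nat.card E := Set.ncard_smul_set _ _
      have hle : Nat.card E ≤ d := by
        rw [← hcard, ← hA]
        exact Set.ncard_le_ncard hsub (Set.toFinite _)
      refine lt_of_le_of_ne hle fun hEd => hAx ?_
      have hED : E = D := subgroup_eq_of_card_eq (hEd.trans hD.symm)
      have hAE : a • (E : Set C) = A :=
        Set.eq_of_subset_of_ncard_le hsub (by rw [hcard, hEd, hA]) (Set.toFinite _)
      have hax : a • x = A' := Subtype.ext ?_
      · exact hax ▸ MulAction.mem_orbit x a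
      change a • (D : Set C) = A'.1
      rw [hAA, ← hED, hAE]
    have := sub_mem hX hcompl
    rwa [cls_eq_add_compl (orbitSub (G := C) x), add_sub_cancel_right, cls_orbitSub,
      hstab] at this

theorem exists_frobeniusWielandt (h : Nat.card C = Nat.card G) (x : BurnsideRing C) :
    ∃ y : BurnsideRing G, ∀ (U : Subgroup G) (V : Subgroup C),
      Nat.card V = Nat.card U → mark U y = mark V x := by
  change x ∈ fwDomain G C
  induction x using BurnsideRing.induction with
  | hcls X =>
    refine cls_mem_fwDomain_of_stabilizer (d := Nat.card C + 1)
      (fun D _ => cls_quotient_mem_fwDomain h _ D rfl) _ X rfl fun x => ?_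
    exact Nat.lt_succ_of_le (Subgroup.card_le_card_group _)
  | hadd a b ha hb => exact add_mem ha hb
  | hneg a ha => exact neg_mem ha

/-- The Frobenius-Wielandt morphism `α : B(C) → B(G)`, where `C` is a cyclic group of order `|G|`:
for `x` in `B(C)`, `α x` is the element of `B(G)` such that `|(α x) ^ U| = |x ^ V|` for every
subgroup `U` of `G`, where `V` is the subgroup of `C` of order `|U|`. -/
noncomputable def frobeniusWielandt (h : Nat.card C = Nat.card G) :
    BurnsideRing C →+* BurnsideRing G :=
  have ext : ∀ {a b : BurnsideRing G}, (∀ (U : Subgroup G) (V : Subgroup C),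
      Nat.card V = Nat.card U → mark U a = mark U b) → a = b := fun hab =>
    mark_ext fun U => by
      obtain ⟨V, hV⟩ := exists_subgroup_card (h ▸ Subgroup.card_subgroup_dvd_card U)
      exact hab U V hV
  have spec : ∀ (x : BurnsideRing C) (U : Subgroup G) (V : Subgroup C),
      Nat.card V = Nat.card U →
        mark U (Classical.choose (exists_frobeniusWielandt h x)) = mark V x :=
    fun x => Classical.choose_spec (exists_frobeniusWielandt h x)
  { toFun := fun x => Classical.choose (exists_frobeniusWielandt h x)
    map_one' := ext fun U V hUV => by rw [spec _ U V hUV, map_one, map_one]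
    map_mul' := fun a b => ext fun U V hUV => by
      rw [map_mul, spec _ U V hUV, spec _ U V hUV, spec _ U V hUV, map_mul]
    map_zero' := ext fun U V hUV => by rw [spec _ U V hUV, map_zero, map_zero]
    map_add' := fun a b => ext fun U V hUV => by
      rw [map_add, spec _ U V hUV, spec _ U V hUV, spec _ U V hUV, map_add] }

/-- The defining property of the Frobenius-Wielandt morphism. -/
theorem mark_frobeniusWielandt (h : Nat.card C = Nat.card G) (x : BurnsideRing C)
    (U : Subgroup G) (V : Subgroup C) (hUV : Nat.card V = Nat.card U) :
    mark U (frobeniusWielandt h x) = mark V x :=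
  Classical.choose_spec (exists_frobeniusWielandt h x) U V hUV

end FrobeniusWielandt

/-! ### Deflation -/

section Deflation

variable {G : Type u} [Group G] (N : Subgroup G) [N.Normal]

/-- The set `N \ X` of `N`-orbits of a `G`-set `X`. -/
def NOrbits (X : Type u) [MulAction G X] : Type u := MulAction.orbitRel.Quotient N X

instance (X : Type u) [MulAction G X] [Finite X] : Finite (NOrbits N X) :=
  inferInstanceAs (Finite (Quotient (MulAction.orbitRel N X)))

theorem smul_orbitRel {X : Type u} [MulAction G X] {g h : G} {x y : X} (hgh : g⁻¹ * h ∈ N)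
    (hxy : MulAction.orbitRel N X x y) : MulAction.orbitRel N X (g • x) (h • y) := by
  obtain ⟨n, rfl⟩ := hxy
  have hm : g * n * (g⁻¹ * h)⁻¹ * g⁻¹ ∈ N := by
    rw [mul_assoc g]
    exact Subgroup.Normal.conj_mem inferInstance _ (N.mul_mem n.2 (N.inv_mem hgh)) g
  refine ⟨⟨_, hm⟩, ?_⟩
  change (g * n * (g⁻¹ * h)⁻¹ * g⁻¹) • h • y = g • (n : G) • y
  simp only [← mul_smul]
  congr 1
  group

/-- The action of `G ⧸ N` on the set of `N`-orbits of a `G`-set `X`: `(gN) • (Nx) = N(gx)`. -/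
instance (X : Type u) [MulAction G X] : MulAction (G ⧸ N) (NOrbits N X) where
  smul q o := Quotient.liftOn₂ q o
    (fun g x => (Quotient.mk (MulAction.orbitRel N X) (g • x) : NOrbits N X))
    (fun _ _ _ _ hg hx => Quotient.sound
      (smul_orbitRel N (QuotientGroup.leftRel_apply.mp hg) hx))
  one_smul := by
    rintro ⟨x⟩
    exact congrArg (Quotient.mk (MulAction.orbitRel N X)) (one_smul G x)
  mul_smul := by
    rintro ⟨g⟩ ⟨h⟩ ⟨x⟩
    exact congrArg (Quotient.mk (MulAction.orbitRel N X)) (mul_smul g h x)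

/-- Deflation on isomorphism classes of finite `G`-sets. -/
noncomputable def deflationClass : IsoClass G → BurnsideRing (G ⧸ N) :=
  Quotient.lift (fun X => cls (G ⧸ N) (NOrbits N X.carrier)) (by
    rintro X Y ⟨e, he⟩
    refine cls_congr (Quotient.congr e fun x y => ?_) ?_
    · constructor
      · rintro ⟨n, rfl⟩
        exact ⟨n, (he n y).symm⟩
      · rintro ⟨n, hn⟩
        exact ⟨n, e.injective ((he n y).trans hn)⟩
    · rintro ⟨g⟩ ⟨x⟩
      exact congrArg (Quotient.mk (MulAction.orbitRel N Y.carrier)) (he g x))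

/-- The `N`-orbits of a disjoint union. -/
def nOrbitsSum (X Y : Type u) [MulAction G X] [MulAction G Y] :
    NOrbits N (X ⊕ Y) ≃ NOrbits N X ⊕ NOrbits N Y where
  toFun := Quotient.lift (Sum.map (Quotient.mk (MulAction.orbitRel N X))
      (Quotient.mk (MulAction.orbitRel N Y))) (by
    rintro (x | x) (y | y) ⟨n, hn⟩
    · exact congrArg Sum.inl (Quotient.sound ⟨n, Sum.inl_injective hn⟩)
    · exact absurd hn Sum.inr_ne_inl
    · exact absurd hn Sum.inl_ne_inr
    · exact congrArg Sum.inr (Quotient.sound ⟨n, Sum.inr_injective hn⟩))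
  invFun := Sum.elim
    (Quotient.lift (fun x => (Quotient.mk (MulAction.orbitRel N (X ⊕ Y)) (Sum.inl x))) (by
      rintro x y ⟨n, hn⟩
      exact Quotient.sound ⟨n, congrArg Sum.inl hn⟩))
    (Quotient.lift (fun x => (Quotient.mk (MulAction.orbitRel N (X ⊕ Y)) (Sum.inr x))) (by
      rintro x y ⟨n, hn⟩
      exact Quotient.sound ⟨n, congrArg Sum.inr hn⟩))
  left_inv := by rintro ⟨x | x⟩ <;> rfl
  right_inv := by
    rintro (x | x) <;> induction x using Quotient.inductionOn <;> rfl

/-- The deflation map `B(G) → B(G ⧸ N)`: the additive map sending the class of a finite `G`-set `X`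
to the class of the `G ⧸ N`-set of `N`-orbits of `X`. -/
noncomputable def deflation : BurnsideRing G →+ BurnsideRing (G ⧸ N) :=
  addLift (deflationClass N) (fun X Y => by
    change cls (G ⧸ N) (NOrbits N (X.carrier ⊕ Y.carrier))
      = cls (G ⧸ N) (NOrbits N X.carrier) + cls (G ⧸ N) (NOrbits N Y.carrier)
    rw [← cls_sum]
    refine cls_congr (nOrbitsSum N _ _) ?_
    rintro ⟨g⟩ ⟨x | x⟩ <;> rfl)

theorem deflation_cls (X : Type u) [MulAction G X] [Finite X] :
    deflation N (cls G X) = cls (G ⧸ N) (NOrbits N X) :=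
  addLift_cls _ _ X

end Deflation

/-! ### Bouc's constants -/

open Classical in
/-- Bouc's constant `m_{L, K} = (1 / |L|) ∑_{X K = L} |X| μ(X, L)` for a normal subgroup `K` of a
finite group `L`, the sum being over the subgroups `X` of `L` with `X K = L` and `μ` being the
Möbius function of the poset of subgroups of `L`. -/
noncomputable def boucConstant {L : Type u} [Group L] [Finite L] (K : Subgroup L) : ℚ :=
  letI : Fintype (Subgroup L) := Fintype.ofFinite _
  letI : LocallyFiniteOrder (Subgroup L) := Fintype.toLocallyFiniteOrder (α := Subgroup L)
  1 / (Nat.card L : ℚ) *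
    ∑ X ∈ Finset.univ.filter
        (fun X : Subgroup L => (X : Set L) * (K : Set L) = Set.univ),
      (Nat.card X : ℚ) * (IncidenceAlgebra.mu ℚ : IncidenceAlgebra ℚ (Subgroup L)) X ⊤

end Burnside

/-! The idea is to compute the marks of a deflation and test the commutation on one element. For `N
≤ T` and a finite `G`-set `X`, an `N`-orbit `Nx` is fixed by `T/N` iff `Tx = Nx`, i.e. iff `T_x N =
T`, where `T_x` is the stabilizer of `x` in `T`. Such an orbit has `|T|/|T_x|` points, so `|T| ·
|(N\X)^{T/N}|` is the sum of `|T_x|` over the points `x` with `T_x N = T`. Möbius inversion turns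
the condition `T_x = S` into conditions `Y ≤ T_x`. Hence the mark of `Def a` at `T/N` is a fixed
rational combination of the marks of `a` at the subgroups `Y` of `T` (`mark_deflation`), and its
coefficient at `Y = T` is exactly `m_{T,N}`. If `a` has zero marks at all proper subgroups of `T`,
only that term survives (`mark_deflation_of_mark_eq_zero`).

Now let `a ∈ B(C)` be `|C|` times the rational idempotent at `C_T` (`exists_mark_eq_ite`). Its mark
is `|C|` at `C_T` and `0` elsewhere, so `α a` has mark `|C|` at `T` and `0` at every proper subgroup
of `T`. The mark at `T/N` of `Def (α a)` is therefore `m_{T,N} |C|`. The mark at `T/N` of `α (Def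
a)` is that of `Def a` at `C_T/C_N`, a group of the same order, which is `m_{C_T,C_N} |C|`.
Cancelling `|C|` gives the equality. -/

namespace Burnside

/-! ### Marks of a deflation. -/

section DeflationMarks

variable {G : Type u} [Group G]

open Classical in
/-- The Möbius function of the poset of subgroups of a finite group. -/
noncomputable def subgroupMu {L : Type u} [Group L] [Finite L] (R : Type*) [Ring R] :
    Subgroup L → Subgroup L → R :=
  letI : Fintype (Subgroup L) := Fintype.ofFinite _
  letI : LocallyFiniteOrder (Subgroup L) := Fintype.toLocallyFiniteOrder (α := Subgroup L)
  (IncidenceAlgebra.mu R : IncidenceAlgebra R (Subgroup L))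

open Classical in
/-- The coefficient of `|x ^ Y|` in the number of fixed points of a deflation. The coefficient
for `Y = ⊤` is Bouc's constant. -/
noncomputable def deflationCoeff {L : Type u} [Group L] [Finite L] (K : Subgroup L)
    (Y : Subgroup L) : ℚ :=
  letI : Fintype (Subgroup L) := Fintype.ofFinite _
  1 / (Nat.card L : ℚ) *
    ∑ X ∈ Finset.univ.filter
        (fun X : Subgroup L => (X : Set L) * (K : Set L) = Set.univ),
      (Nat.card X : ℚ) * subgroupMu ℚ X Y

/-- `subgroupMu` is built from the same instances as the Möbius function inside `boucConstant`, so
the two sums agree definitionally. -/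
theorem deflationCoeff_top {L : Type u} [Group L] [Finite L] (K : Subgroup L) :
    deflationCoeff K ⊤ = boucConstant K := rfl

-- Since `μ(A, Y) = 0` unless `A ≤ Y`, the lower bound of the usual interval sum can be dropped. In
-- this form it inverts sums over all subgroups contained in a stabilizer.
open Classical in
theorem sum_subgroupMu_right {L : Type u} [Group L] [Finite L] [Fintype (Subgroup L)]
    (R : Type*) [Ring R] (A B : Subgroup L) :
    ∑ Y ∈ Finset.univ.filter (fun Y => Y ≤ B), subgroupMu R A Y = if A = B then 1 else 0 := by
  let : LocallyFiniteOrder (Subgroup L) := Fintype.toLocallyFiniteOrder (α := Subgroup L)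
  have h := IncidenceAlgebra.sum_Icc_mu_right (𝕜 := R) A B
  rw [← h]
  symm
  unfold subgroupMu
  convert Finset.sum_subset (s₁ := Finset.Icc A B)
    (s₂ := Finset.univ.filter (fun Y => Y ≤ B)) (f := fun Y => IncidenceAlgebra.mu R A Y)
    (fun Y hY => by simpa using (Finset.mem_Icc.mp hY).2) (fun Y hY hY' =>
      IncidenceAlgebra.apply_eq_zero_of_not_le (fun hA => hY' (Finset.mem_Icc.mpr
        ⟨hA, (Finset.mem_filter.mp hY).2⟩)) _) using 4
  -- What remains is the discrepancy between the instance chosen inside `subgroupMu` and the one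
  -- coming from the ambient `Fintype`.
  exact Subsingleton.elim _ _

-- The dual form, without the upper bound because `μ(Y, B) = 0` unless `Y ≤ B`. It produces the
-- idempotents of `B(C)`.
open Classical in
theorem sum_subgroupMu_left {L : Type u} [Group L] [Finite L] [Fintype (Subgroup L)]
    (R : Type*) [Ring R] (A B : Subgroup L) :
    ∑ Y ∈ Finset.univ.filter (fun Y => A ≤ Y), subgroupMu R Y B = if A = B then 1 else 0 := by
  let : LocallyFiniteOrder (Subgroup L) := Fintype.toLocallyFiniteOrder (α := Subgroup L)
  have h := IncidenceAlgebra.sum_Icc_mu_left (𝕜 := R) A B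
  rw [← h]
  symm
  unfold subgroupMu
  convert Finset.sum_subset (s₁ := Finset.Icc A B)
    (s₂ := Finset.univ.filter (fun Y => A ≤ Y)) (f := fun Y => IncidenceAlgebra.mu R Y B)
    (fun Y hY => by simpa using (Finset.mem_Icc.mp hY).1) (fun Y hY hY' =>
      IncidenceAlgebra.apply_eq_zero_of_not_le (fun hA => hY' (Finset.mem_Icc.mpr
        ⟨(Finset.mem_filter.mp hY).2, hA⟩)) _) using 4
  exact Subsingleton.elim _ _

variable (N T : Subgroup G)

/-- The coset of `t` sends `Nx` to `N(tx)`, so being fixed means `Tx ⊆ Nx`; the reverse inclusion is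
automatic from `N ≤ T`. -/
theorem mk_mem_fixedPoints_map_iff [N.Normal] (hNT : N ≤ T) {X : Type u} [MulAction G X] (x : X) :
    (Quotient.mk (MulAction.orbitRel N X) x : NOrbits N X)
        ∈ MulAction.fixedPoints (T.map (QuotientGroup.mk' N)) (NOrbits N X)
      ↔ MulAction.orbit T x = MulAction.orbit N x := by
  have hle : MulAction.orbit N x ⊆ MulAction.orbit T x := by
    rintro _ ⟨n, rfl⟩
    exact ⟨⟨n, hNT n.2⟩, rfl⟩
  constructor
  · intro h
    refine Set.Subset.antisymm ?_ hle
    rintro _ ⟨t, rfl⟩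
    exact Quotient.exact (h ⟨QuotientGroup.mk' N t, Subgroup.mem_map_of_mem _ t.2⟩)
  · rintro h ⟨_, t, ht, rfl⟩
    refine Quotient.sound (s := MulAction.orbitRel N X) (a := t • x) ?_
    change t • x ∈ MulAction.orbit N x
    rw [← h]
    exact ⟨⟨t, ht⟩, rfl⟩

/-- Frattini argument: `N` is transitive on `Tx` iff `T` is the product of a point stabilizer and
`N`. -/
theorem stabilizer_mul_eq_univ_iff (hNT : N ≤ T) {X : Type u} [MulAction G X] (x : X) :
    (MulAction.stabilizer T x : Set T) * (N.subgroupOf T : Set T) = Set.univ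
      ↔ MulAction.orbit T x = MulAction.orbit N x := by
  have hle : MulAction.orbit N x ⊆ MulAction.orbit T x := by
    rintro _ ⟨n, rfl⟩
    exact ⟨⟨n, hNT n.2⟩, rfl⟩
  constructor
  · intro h
    refine Set.Subset.antisymm ?_ hle
    rintro _ ⟨t, rfl⟩
    -- Factoring `t⁻¹ = s n` instead of `t` gives `t = n⁻¹ s⁻¹`, in which the stabilizer part acts
    -- first and disappears.
    obtain ⟨s, hs, n, hn, hsn⟩ := Set.mem_mul.mp (h.symm ▸ Set.mem_univ t⁻¹)
    refine ⟨⟨(n : G)⁻¹, N.inv_mem hn⟩, ?_⟩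
    have ht : t = n⁻¹ * s⁻¹ := by rw [← mul_inv_rev, hsn, inv_inv]
    change (n⁻¹ : T) • x = t • x
    rw [ht, mul_smul, MulAction.mem_stabilizer_iff.mp ((MulAction.stabilizer T x).inv_mem hs)]
  · intro h
    refine Set.eq_univ_of_forall fun t => ?_
    obtain ⟨n, hn⟩ : t⁻¹ • x ∈ MulAction.orbit N x := h ▸ ⟨t⁻¹, rfl⟩
    -- From `t⁻¹ x = n x` one gets `t n ∈ T_x`, so `t = (t n) n⁻¹` is the required factorization.
    refine Set.mem_mul.mpr ⟨t * ⟨n, hNT n.2⟩, ?_, (⟨n, hNT n.2⟩ : T)⁻¹, ?_, by group⟩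
    · rw [SetLike.mem_coe, MulAction.mem_stabilizer_iff, mul_smul]
      change t • (n • x) = x
      rw [show n • x = t⁻¹ • x from hn, smul_inv_smul]
    · exact (N.subgroupOf T).inv_mem (Subgroup.mem_subgroupOf.mpr n.2)

-- Weighting each point by the order of its stabilizer makes every fixed `N`-orbit contribute the
-- same amount: it is a full `T`-orbit, with `|T|/|T_x|` points of weight `|T_x|`.
open Classical in
theorem card_mul_card_fixedPoints_nOrbits [Finite G] [N.Normal] (hNT : N ≤ T) (X : Type u) [MulAction G X]
    [Fintype X] :
    (Nat.card T : ℚ) * Nat.card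
        (MulAction.fixedPoints (T.map (QuotientGroup.mk' N)) (NOrbits N X))
      = ∑ x : X, if (MulAction.stabilizer T x : Set T) * (N.subgroupOf T : Set T) = Set.univ
          then (Nat.card (MulAction.stabilizer T x) : ℚ) else 0 := by
  let : Fintype (NOrbits N X) := Fintype.ofFinite _
  let π : X → NOrbits N X := Quotient.mk (MulAction.orbitRel N X)
  let F := MulAction.fixedPoints (T.map (QuotientGroup.mk' N)) (NOrbits N X)
  rw [← Finset.sum_fiberwise (s := Finset.univ) (g := π)]
  have hfib : ∀ o : NOrbits N X, (∑ x ∈ Finset.univ.filter (fun x => π x = o),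
      if (MulAction.stabilizer T x : Set T) * (N.subgroupOf T : Set T) = Set.univ
        then (Nat.card (MulAction.stabilizer T x) : ℚ) else 0)
      = if o ∈ F then (Nat.card T : ℚ) else 0 := by
    intro o
    have hiff : ∀ x ∈ Finset.univ.filter (fun x => π x = o),
        ((MulAction.stabilizer T x : Set T) * (N.subgroupOf T : Set T) = Set.univ ↔ o ∈ F) := by
      intro x hx
      rw [stabilizer_mul_eq_univ_iff N T hNT, ← (Finset.mem_filter.mp hx).2]
      exact (mk_mem_fixedPoints_map_iff N T hNT x).symm
    rw [Finset.sum_congr rfl fun x hx => if_congr (hiff x hx) rfl rfl]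
    split_ifs with ho
    · obtain ⟨x₀, hx₀⟩ : ∃ x, π x = o := Quotient.exists_rep o
      have hcard : ∀ x ∈ Finset.univ.filter (fun x => π x = o),
          (Nat.card (MulAction.stabilizer T x) : ℚ)
            = Nat.card T / (Finset.univ.filter (fun x => π x = o)).card := by
        intro x hx
        -- On a fixed orbit the fibre of `π` is a whole `T`-orbit, so orbit-stabilizer gives the
        -- weight.
        have horb : MulAction.orbit T x = (Finset.univ.filter (fun x => π x = o) : Finset X) := by
          rw [(stabilizer_mul_eq_univ_iff N T hNT x).mp ((hiff x hx).mpr ho)]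
          ext y
          rw [Finset.mem_coe, Finset.mem_filter, ← (Finset.mem_filter.mp hx).2]
          simp only [Finset.mem_univ, true_and]
          exact Quotient.eq (r := MulAction.orbitRel N X).symm
        have hne : ((Finset.univ.filter (fun x => π x = o)).card : ℚ) ≠ 0 :=
          Nat.cast_ne_zero.mpr (Finset.card_ne_zero_of_mem hx)
        have h := Nat.card_congr (MulAction.orbitProdStabilizerEquivGroup T x)
        rw [Nat.card_prod, horb, Nat.card_coe_set_eq, Set.ncard_coe_finset] at h
        rw [eq_div_iff hne, ← h]
        push_cast
        ring
      rw [Finset.sum_congr rfl hcard, Finset.sum_const, nsmul_eq_mul]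
      refine mul_div_cancel₀ _ (Nat.cast_ne_zero.mpr
        (Finset.card_ne_zero_of_mem (a := x₀) ?_))
      exact Finset.mem_filter.mpr ⟨Finset.mem_univ _, hx₀⟩
    · exact Finset.sum_const_zero
  rw [Finset.sum_congr rfl fun o _ => hfib o, ← Finset.sum_filter, Finset.sum_const, nsmul_eq_mul,
    mul_comm]
  congr 2
  rw [Nat.card_eq_fintype_card, Fintype.card_subtype]

-- Writing the mark as a sum of indicators over points allows it to be interchanged with sums over
-- subgroups.
open Classical in
theorem card_fixedPoints_map_subtype {X : Type u} [MulAction G X] [Fintype X] (Y : Subgroup T) :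
    (Nat.card (MulAction.fixedPoints (Y.map T.subtype) X) : ℚ)
      = ∑ x : X, if Y ≤ MulAction.stabilizer T x then 1 else 0 := by
  rw [Finset.sum_boole, Nat.card_eq_fintype_card, Fintype.card_subtype]
  congr 2
  ext x
  simp only [Finset.mem_filter, Finset.mem_univ, true_and]
  constructor
  · intro h t ht
    exact h ⟨t, Subgroup.mem_map_of_mem T.subtype ht⟩
  · rintro h ⟨_, t, ht, rfl⟩
    exact h ht

/-- The numbers of fixed points of a deflation in terms of numbers of fixed points. -/
theorem mark_deflation [Finite G] [N.Normal] [Fintype (Subgroup T)] (hNT : N ≤ T) (a : BurnsideRing G) :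
    (mark (T.map (QuotientGroup.mk' N)) (deflation N a) : ℚ)
      = ∑ Y : Subgroup T, deflationCoeff (N.subgroupOf T) Y * mark (Y.map T.subtype) a := by
  classical
  induction a using BurnsideRing.induction with
  | hcls X =>
    let : Fintype X := Fintype.ofFinite X
    have hT : (Nat.card T : ℚ) ≠ 0 := Nat.cast_ne_zero.mpr Nat.card_pos.ne'
    rw [deflation_cls, mark_cls]
    simp only [mark_cls, Int.cast_natCast, card_fixedPoints_map_subtype]
    refine mul_left_cancel₀ hT ?_
    rw [card_mul_card_fixedPoints_nOrbits N T hNT X]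
    simp only [Finset.mul_sum, mul_ite, mul_one, mul_zero]
    -- With the sum over points outermost, the identity is checked separately at each `x`.
    rw [Finset.sum_comm]
    refine Finset.sum_congr rfl fun x _ => ?_
    rw [← Finset.sum_filter]
    have hY : ∀ Y : Subgroup T, (Nat.card T : ℚ) * deflationCoeff (N.subgroupOf T) Y
        = ∑ S ∈ Finset.univ.filter
            (fun S : Subgroup T => (S : Set T) * (N.subgroupOf T : Set T) = Set.univ),
          (Nat.card S : ℚ) * subgroupMu ℚ S Y := by
      intro Y
      unfold deflationCoeff
      rw [← mul_assoc, mul_one_div_cancel hT, one_mul]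
      congr!
    simp only [hY]
    rw [Finset.sum_comm]
    -- Möbius inversion over `Y ≤ T_x` leaves only the term `S = T_x`.
    simp only [← Finset.mul_sum, sum_subgroupMu_right, mul_ite, mul_one, mul_zero]
    rw [Finset.sum_ite_eq']
    simp only [Finset.mem_filter, Finset.mem_univ, true_and]
  | hadd a b ha hb =>
    simp only [map_add, Int.cast_add, ha, hb, mul_add, Finset.sum_add_distrib]
  | hneg a ha =>
    simp only [map_neg, Int.cast_neg, ha, mul_neg, Finset.sum_neg_distrib]

end DeflationMarks

/-! ### Idempotents and orders of subgroups on the cyclic side. -/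

/-- In an abelian group an element fixing one coset of `E` lies in `E` and fixes them all, so fixed
points are all or nothing. -/
theorem mark_cls_quotient {C : Type v} [CommGroup C] [Finite C] (D E : Subgroup C)
    [Decidable (D ≤ E)] :
    mark D (cls C (C ⧸ E)) = if D ≤ E then (Nat.card (C ⧸ E) : ℤ) else 0 := by
  have hmem : ∀ (g x : C), g • (x : C ⧸ E) = x ↔ g ∈ E := by
    intro g x
    change ((g * x : C) : C ⧸ E) = x ↔ _
    rw [eq_comm, QuotientGroup.eq, mul_comm g, inv_mul_cancel_left]
  rw [mark_cls]
  split_ifs with h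
  · have : MulAction.fixedPoints D (C ⧸ E) = Set.univ := by
      refine Set.eq_univ_of_forall fun q => ?_
      induction q using QuotientGroup.induction_on with
      | H x => exact fun d => (hmem d x).mpr (h d.2)
    exact congrArg Nat.cast
      ((congrArg (fun S : Set (C ⧸ E) => Nat.card S) this).trans Nat.card_univ)
  · rw [Nat.cast_eq_zero, Nat.card_eq_zero]
    refine Or.inl ⟨fun ⟨q, hq⟩ => h fun d hd => ?_⟩
    induction q using QuotientGroup.induction_on with
    | H x => exact (hmem d x).mp (hq ⟨d, hd⟩)

open Classical in
/-- A multiple of the idempotent of a subgroup `B` of an abelian group. -/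
theorem exists_mark_eq_ite {C : Type v} [CommGroup C] [Finite C] (B : Subgroup C) :
    ∃ a : BurnsideRing C, ∀ D : Subgroup C,
      mark D a = if D = B then (Nat.card C : ℤ) else 0 := by
  let : Fintype (Subgroup C) := Fintype.ofFinite _
  -- The factor `|E|` completes `|C/E|` to the constant `|C|`, so the mark at `D` is `|C|` times the
  -- sum of `μ(E, B)` over `E ≥ D`. Multiplying the idempotent by `|C|` keeps the coefficients
  -- integral.
  refine ⟨∑ E : Subgroup C, (subgroupMu ℤ E B * Nat.card E) • cls C (C ⧸ E), fun D => ?_⟩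
  have h : ∀ E : Subgroup C, (subgroupMu ℤ E B * Nat.card E) *
      (if D ≤ E then (Nat.card (C ⧸ E) : ℤ) else 0)
      = Nat.card C * if D ≤ E then subgroupMu ℤ E B else 0 := by
    intro E
    split_ifs
    · rw [Subgroup.card_eq_card_quotient_mul_card_subgroup E]
      push_cast
      ring
    · ring
  simp only [map_sum, map_zsmul, mark_cls_quotient, smul_eq_mul, h]
  rw [← Finset.mul_sum, ← Finset.sum_filter, sum_subgroupMu_left, mul_ite, mul_one, mul_zero]

theorem card_map_mk'_mul_card {G : Type u} [Group G] {N T : Subgroup G} [N.Normal]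
    (hNT : N ≤ T) : Nat.card (T.map (QuotientGroup.mk' N)) * Nat.card N = Nat.card T := by
  have h := Subgroup.card_mul_index ((QuotientGroup.mk' N).domRestrict T).ker
  rw [Subgroup.index_ker, MonoidHom.domRestrict_range, MonoidHom.ker_domRestrict,
    QuotientGroup.ker_mk', mul_comm] at h
  rw [← h, Nat.card_congr (Subgroup.subgroupOfEquivOfLe hNT).toEquiv]

/-- The cyclic group `W` contains a subgroup of order `|V|`, which must be `V` by uniqueness in `C`.
-/
theorem le_of_card_dvd_card {C : Type v} [CommGroup C] [IsCyclic C] [Finite C]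
    {V W : Subgroup C} (h : Nat.card V ∣ Nat.card W) : V ≤ W := by
  obtain ⟨V', hV'⟩ := exists_subgroup_card (C := W) h
  have : V = V'.map W.subtype := subgroup_eq_of_card_eq
    (by rw [Subgroup.card_map_of_injective W.subtype_injective, hV'])
  exact this ▸ Subgroup.map_subtype_le V'

/-- If the only subgroup of `T` on which `a` has fixed points is `T` itself, the number of fixed
points of `T ⧸ N` on the deflation of `a` is a multiple of Bouc's constant. -/
theorem mark_deflation_of_mark_eq_zero {G : Type u} [Group G] [Finite G] (N T : Subgroup G)
    [N.Normal] (hNT : N ≤ T) (a : BurnsideRing G)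
    (ha : ∀ U < T, mark U a = 0) :
    (mark (T.map (QuotientGroup.mk' N)) (deflation N a) : ℚ)
      = boucConstant (N.subgroupOf T) * mark T a := by
  let : Fintype (Subgroup T) := Fintype.ofFinite _
  rw [mark_deflation N T hNT, Finset.sum_eq_single ⊤, deflationCoeff_top,
    ← MonoidHom.range_eq_map, Subgroup.range_subtype]
  · intro Y _ hY
    rw [ha, Int.cast_zero, mul_zero]
    -- A subgroup `Y ≠ ⊤` of `T` has a proper image in `T`, because the inclusion of `T` in `G` is
    -- injective on subgroups.
    refine lt_of_le_of_ne (Subgroup.map_subtype_le Y) fun h => hY ?_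
    rwa [← Subgroup.map_subtype_inj, ← MonoidHom.range_eq_map, Subgroup.range_subtype]
  · exact fun h => absurd (Finset.mem_univ _) h

end Burnside

/-! ### Comparison of the two constants. -/

theorem mainTheorem8 {G : Type*} [Group G] [Finite G] (N : Subgroup G) [N.Normal]
    {C : Type*} [CommGroup C] [IsCyclic C] [Finite C] (hC : Nat.card C = Nat.card G)
    (CN : Subgroup C) (hCN : Nat.card CN = Nat.card N)
    (hcomm : ∀ x : Burnside.BurnsideRing C,
      Burnside.deflation N (Burnside.frobeniusWielandt hC x)
        = Burnside.frobeniusWielandt (Burnside.card_quotient_eq hC hCN)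
            (Burnside.deflation CN x))
    (T : Subgroup G) (hNT : N ≤ T) (CT : Subgroup C) (hCT : Nat.card CT = Nat.card T) :
    Burnside.boucConstant (N.subgroupOf T) = Burnside.boucConstant (CN.subgroupOf CT) := by
  classical
  have hCNT : CN ≤ CT := Burnside.le_of_card_dvd_card
    (hCN ▸ hCT ▸ Subgroup.card_dvd_of_le hNT)
  obtain ⟨a, ha⟩ := Burnside.exists_mark_eq_ite CT
  -- Equal orders mean that the FW morphism of `G/N` matches the mark at `T/N` with the mark at
  -- `C_T/C_N`.
  have hquot : Nat.card (CT.map (QuotientGroup.mk' CN))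
      = Nat.card (T.map (QuotientGroup.mk' N)) := by
    refine Nat.eq_of_mul_eq_mul_right (Nat.card_pos (α := N)) ?_
    rw [Burnside.card_map_mk'_mul_card hNT, ← hCN, Burnside.card_map_mk'_mul_card hCNT, hCT]
  have key := congrArg (fun y => (Burnside.mark (T.map (QuotientGroup.mk' N)) y : ℚ)) (hcomm a)
  simp only [Burnside.mark_frobeniusWielandt _ _ _ _ hquot] at key
  rw [Burnside.mark_deflation_of_mark_eq_zero N T hNT,
    Burnside.mark_deflation_of_mark_eq_zero CN CT hCNT,
    Burnside.mark_frobeniusWielandt hC a T CT hCT, ha, if_pos rfl] at key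
  · exact mul_right_cancel₀
      (Int.cast_ne_zero.mpr (Nat.cast_ne_zero.mpr (Nat.card_pos (α := C)).ne')) key
  · exact fun U hU => by rw [ha, if_neg hU.ne]
  · intro U hU
    obtain ⟨V, hV⟩ := Burnside.exists_subgroup_card (C := C)
      (hC ▸ Subgroup.card_subgroup_dvd_card U)
    rw [Burnside.mark_frobeniusWielandt hC a U V hV, ha, if_neg]
    -- If the subgroup of order `|U|` were `C_T`, then `|U| = |T|`, contradicting `U < T`.
    rintro rfl
    exact hU.ne (Subgroup.eq_of_le_of_card_ge hU.le (by rw [← hCT, hV]))
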